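/- Let $p$ be a prime, $s \ge 1$ an integer and $\eta > 0$ a real number. There is a constant $C > 0$, depending only on $p$, $s$ and $\eta$, such that the following holds. Let $q = p^\alpha$ with an integer $\alpha \ge 1$, let $1 \le e_1 < \dots < e_s$ be integers, and let $$F(X) = \sum_{j=1}^s A_j X^{e_j} \in (\mathbb{Z}/q\mathbb{Z})[X]$$ with $\gcd(A_1, \dots, A_s, p) = 1$, that is, with at least one coefficient $A_j$ not divisible by $p$. Put $$\Delta(e_1, \dots, e_s) = \det\left( \binom{e_j}{i} \right)_{1 \le i, j \le s} = \prod_{i=1}^s \frac{e_i}{i!} \prod_{1 \le i < j \le s} (e_j - e_i)$$ and let $\rho = \mathrm{ord}_p\, \Delta(e_1, \dots, e_s)$ be the largest integer with $p^\rho \mid \Delta(e_1, \dots, e_s)$. If $$p^\rho \le s^{-1} q^\eta,$$ then $$\left| \sum_{\substack{x = 1 \\ \gcd(x, q) = 1}}^{q} \exp\left( \frac{2 \pi i F(x)}{q} \right) \right| \le C\, q^{1 - 1/s + \eta (s+1)/s}.$$ In particular, $C$ does not depend on $\alpha$, on the coefficients $A_j$, on the exponents $e_j$ or on $\deg F$.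 -/

import Mathlib

namespace SparseExpSum

/-- The integer determinant of the `s × s` matrix whose entry in row `i` and column `j`
(both counted from `1`) is the binomial coefficient `e_j` over `i`. -/
def Delta {s : ℕ} (e : Fin s → ℕ) : ℤ :=
  Matrix.det (Matrix.of fun i j : Fin s => ((e j).choose (i.val + 1) : ℤ))

/-- The additive character `exp (2 π i z / m)` on residues `z` modulo `m`,
read on the representative of `z` in `{0, …, m - 1}`. -/
noncomputable def eMod (m : ℕ) (z : ZMod m) : ℂ :=
  Complex.exp (2 * Real.pi * Complex.I * (z.val : ℂ) / (m : ℂ))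

/-- The exponential sum of `F` over the `x` in `{1, …, m}` that are coprime to `m`. -/
noncomputable def expSum (m : ℕ) (F : Polynomial (ZMod m)) : ℂ :=
  ∑ x ∈ (Finset.Icc 1 m).filter (fun x => Nat.gcd x m = 1), eMod m (F.eval (x : ZMod m))

end SparseExpSum

/-!
The estimate combines a local Hua-type bound for exponential sums with an invariant description of
how degenerate a sparse polynomial can be near a unit.

*Local bound.* Let `g` be an integer polynomial such that some coefficient of index `1, …, d` is
prime to `p` while those of index `> d` are divisible by `p`. Then the mean of
`exp (2 π i g(y) / p ^ m)` is `O(p ^ (-m / d))` with a constant depending only on `p` and `d`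
(`exists_hasDecay`). This is a `p`-adic van der Corput argument by induction on `d`. After a
rescaling `y = a + p ^ j z` and removal of the content, either the reduced degree drops, or `g` has
degree exactly `d + 1` modulo a power `p ^ (v + 1)`, with `v` the order of `p` in `d + 1`
(`IsDominated`). In that case the coefficient of index `d` varies linearly with the centre `a`, so
it is very small for at most one residue class modulo `p`. On the other classes the case `d`
applies, and the exceptional class reproduces the situation with `m` replaced by `m - (d + 1)`, at
the cost of a factor `1 / p`. The resulting recursion (`norm_mean_le_of_dominated`) sums to
`O(p ^ (-m / (d + 1)))`.

*Sparse polynomials.* For `F = ∑ A_j X ^ e_j` and a unit `a`, the coefficient of `y ^ i` in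
`F (a + p ^ k y)` is `p ^ (k i) a ^ (-i) B_i` with `B_i = ∑ A_j a ^ e_j (e_j choose i)`. By Cramer's
rule `B_1, …, B_s` are not all divisible by `p ^ (ρ + 1)` (`exists_not_dvd_sum_choose`), and
`i! B_i` is an integral combination of them for every `i ≥ 1` (`dvd_factorial_mul_sum_choose`). For
`k = s + 2` the powers of `p` outweigh the factorials, so that after removing a content of order at
most `ρ + O(1)` the polynomial has reduced degree at most `s`. The local bound on each ball then
gives `O(q * (q / p ^ ρ) ^ (-1 / s))`, which is stronger than required since `p ^ ρ ≤ q ^ η`.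
-/

namespace SparseExpSum

open Polynomial Finset

/-! ### Exponential means and rescaling -/

/-- The additive character `exp (2 π i z / q)` as a function of an integer `z`. -/
noncomputable def phase (q : ℕ) (z : ℤ) : ℂ :=
  Complex.exp (2 * Real.pi * Complex.I * (z : ℂ) / (q : ℂ))

lemma norm_phase (q : ℕ) (z : ℤ) : ‖phase q z‖ = 1 := by
  have h : 2 * Real.pi * Complex.I * (z : ℂ) / (q : ℂ)
      = ((2 * Real.pi * z / q : ℝ) : ℂ) * Complex.I := by
    push_cast; ring
  rw [phase, h, Complex.norm_exp_ofReal_mul_I]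

lemma phase_add (q : ℕ) (z w : ℤ) : phase q (z + w) = phase q z * phase q w := by
  rw [phase, phase, phase, ← Complex.exp_add]
  congr 1
  push_cast
  ring

lemma phase_eq_one_of_dvd {q : ℕ} {z : ℤ} (h : (q : ℤ) ∣ z) : phase q z = 1 := by
  obtain ⟨w, rfl⟩ := h
  rcases eq_or_ne q 0 with rfl | hq
  · simp [phase]
  have hq' : (q : ℂ) ≠ 0 := by exact_mod_cast hq
  rw [phase, Complex.exp_eq_one_iff]
  exact ⟨w, by push_cast; field_simp⟩

lemma phase_congr {q : ℕ} {z w : ℤ} (h : (q : ℤ) ∣ z - w) : phase q z = phase q w := by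
  rw [← sub_add_cancel z w, phase_add, phase_eq_one_of_dvd h, one_mul]

lemma phase_mul_left {r : ℕ} (hr : r ≠ 0) (q : ℕ) (z : ℤ) :
    phase (r * q) (r * z) = phase q z := by
  have hr' : (r : ℂ) ≠ 0 := by exact_mod_cast hr
  rw [phase, phase]
  congr 1
  push_cast
  rw [show 2 * (Real.pi : ℂ) * Complex.I * (r * z) = r * (2 * Real.pi * Complex.I * z) by ring,
    mul_div_mul_left _ _ hr']

lemma phase_nat_mul (q n : ℕ) (z : ℤ) : phase q (n * z) = phase q z ^ n := by
  rw [phase, phase, ← Complex.exp_nat_mul]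
  congr 1
  push_cast
  ring

lemma phase_ne_one {q : ℕ} (hq : q ≠ 0) {z : ℤ} (h : ¬ (q : ℤ) ∣ z) : phase q z ≠ 1 := by
  have hq' : (q : ℂ) ≠ 0 := by exact_mod_cast hq
  rw [phase, Ne, Complex.exp_eq_one_iff]
  rintro ⟨n, hn⟩
  refine h ⟨n, ?_⟩
  have h2 : (2 * Real.pi * Complex.I : ℂ) ≠ 0 := Complex.two_pi_I_ne_zero
  rw [div_eq_iff hq', mul_comm (n : ℂ), mul_assoc _ (n : ℂ)] at hn
  have := mul_left_cancel₀ h2 hn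
  rw [mul_comm]
  exact_mod_cast this

lemma sum_range_mul_eq (f : ℕ → ℂ) (A B : ℕ) :
    ∑ y ∈ range (A * B), f y = ∑ a ∈ range A, ∑ z ∈ range B, f (a + A * z) := by
  rw [sum_comm]
  induction B with
  | zero => simp
  | succ B ih =>
    rw [sum_range_succ, ← ih, Nat.mul_succ, sum_range_add]
    simp only [add_comm]

/-- Summing a `Q`-periodic function over one period, `R` times over, and splitting the points
into residue classes modulo `R`. -/
lemma sum_period_split (f : ℤ → ℂ) (Q R : ℕ) (hf : ∀ y z : ℤ, f (y + Q * z) = f y) :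
    (R : ℂ) * ∑ y ∈ range Q, f y
      = ∑ a ∈ range R, ∑ z ∈ range Q, f ((a : ℤ) + R * z) := by
  have h1 := sum_range_mul_eq (fun y => f y) R Q
  have h2 := sum_range_mul_eq (fun y => f y) Q R
  push_cast at h1 h2
  rw [← h1, mul_comm R Q, h2]
  simp only [hf, sum_const, card_range, nsmul_eq_mul, mul_sum]

/-- The mean of `exp (2 π i g(y) / p ^ m)` over the residues `y` modulo `p ^ m`. -/
noncomputable def mean (p : ℕ) (g : ℤ[X]) (m : ℕ) : ℂ :=
  (∑ y ∈ range (p ^ m), phase (p ^ m) (g.eval (y : ℤ))) / (p : ℂ) ^ m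

/-- The polynomial `g (a + p ^ j X)`. -/
noncomputable def rescale (p : ℕ) (g : ℤ[X]) (a : ℤ) (j : ℕ) : ℤ[X] :=
  (taylor a g).comp (C ((p : ℤ) ^ j) * X)

lemma eval_rescale (p : ℕ) (g : ℤ[X]) (a : ℤ) (j : ℕ) (z : ℤ) :
    (rescale p g a j).eval z = g.eval (a + (p : ℤ) ^ j * z) := by
  simp [rescale, taylor_eval, add_comm]

lemma coeff_rescale (p : ℕ) (g : ℤ[X]) (a : ℤ) (j i : ℕ) :
    (rescale p g a j).coeff i = (p : ℤ) ^ (j * i) * (hasseDeriv i g).eval a := by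
  rw [rescale, comp_C_mul_X_coeff, taylor_coeff, pow_mul, mul_comm]

lemma rescale_rescale (p : ℕ) (g : ℤ[X]) (a b : ℤ) (j k : ℕ) :
    rescale p (rescale p g a j) b k = rescale p g (a + (p : ℤ) ^ j * b) (j + k) := by
  refine Polynomial.funext fun z => ?_
  simp only [eval_rescale]
  congr 1
  ring

lemma phase_eval_periodic (q : ℕ) (g : ℤ[X]) (y z : ℤ) :
    phase q (g.eval (y + q * z)) = phase q (g.eval y) := by
  refine phase_congr (dvd_trans ?_ (sub_dvd_eval_sub _ _ g))
  simp

variable {p : ℕ}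

lemma norm_mean_le_one (hp : p.Prime) (g : ℤ[X]) (m : ℕ) : ‖mean p g m‖ ≤ 1 := by
  have hp0 : (0 : ℝ) < (p : ℝ) ^ m := by have := hp.pos; positivity
  rw [mean, norm_div, norm_pow, Complex.norm_natCast, div_le_one hp0]
  refine (norm_sum_le _ _).trans ?_
  simp [norm_phase]

lemma mean_eq_sum_rescale (hp : p.Prime) (g : ℤ[X]) (m j : ℕ) :
    mean p g m = (∑ a ∈ range (p ^ j), mean p (rescale p g a j) m) / (p : ℂ) ^ j := by
  have hp0 : (p : ℂ) ≠ 0 := by exact_mod_cast hp.ne_zero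
  have h := sum_period_split (fun y => phase (p ^ m) (g.eval y)) (p ^ m) (p ^ j)
    (fun y z => phase_eval_periodic _ g y z)
  simp only [mean, eval_rescale, ← sum_div]
  push_cast at h
  rw [← h]
  field_simp

lemma norm_mean_le_of_rescale (hp : p.Prime) (g : ℤ[X]) (m j : ℕ) {B : ℝ}
    (h : ∀ a : ℕ, ‖mean p (rescale p g a j) m‖ ≤ B) : ‖mean p g m‖ ≤ B := by
  have hp0 : (0 : ℝ) < (p : ℝ) ^ j := by have := hp.pos; positivity
  rw [mean_eq_sum_rescale hp g m j, norm_div, norm_pow, Complex.norm_natCast, div_le_iff₀ hp0]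
  refine (norm_sum_le_of_le _ fun a _ => h a).trans_eq ?_
  simp [mul_comm]

/-- A common factor `p ^ c` of the nonconstant coefficients lowers the modulus. -/
lemma norm_mean_eq_of_content (hp : p.Prime) {g h : ℤ[X]} {b : ℤ} {c : ℕ}
    (hg : g = C b + C ((p : ℤ) ^ c) * h) (m : ℕ) :
    ‖mean p g (c + m)‖ = ‖mean p h m‖ := by
  have hp0 : (p : ℂ) ≠ 0 := by exact_mod_cast hp.ne_zero
  have key : (∑ y ∈ range (p ^ (c + m)), phase (p ^ (c + m)) (g.eval (y : ℤ)))
      = phase (p ^ (c + m)) b * ((p : ℂ) ^ c *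
        ∑ y ∈ range (p ^ m), phase (p ^ m) (h.eval (y : ℤ))) := by
    have e1 : ∀ y : ℤ, phase (p ^ (c + m)) (g.eval y)
        = phase (p ^ (c + m)) b * phase (p ^ m) (h.eval y) := fun y => by
      have := phase_mul_left (r := p ^ c) (pow_ne_zero _ hp.ne_zero) (p ^ m) (h.eval y)
      rw [← pow_add] at this
      rw [hg, ← this, ← phase_add]
      simp
    simp only [e1, ← mul_sum]
    congr 1
    have h1 := sum_range_mul_eq (fun y => phase (p ^ m) (h.eval (y : ℤ))) (p ^ m) (p ^ c)
    rw [← pow_add, add_comm m c] at h1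
    rw [h1]
    push_cast
    have := phase_eval_periodic (p ^ m) h
    push_cast at this
    simp [this, mul_sum]
  rw [mean, mean, key, norm_div, norm_mul, norm_phase, one_mul, ← norm_div, pow_add,
    mul_div_mul_left _ _ (pow_ne_zero _ hp0)]

lemma exists_content_quotient {g : ℤ[X]} {r : ℤ} (h : ∀ i, 1 ≤ i → r ∣ g.coeff i) :
    ∃ f : ℤ[X], g = C (g.coeff 0) + C r * f := by
  have : C r ∣ g - C (g.coeff 0) := by
    rw [C_dvd_iff_dvd_coeff]
    intro i
    rcases Nat.eq_zero_or_pos i with rfl | hi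
    · simp
    · rw [coeff_sub, coeff_C_of_ne_zero hi.ne', sub_zero]
      exact h i hi
  obtain ⟨f, hf⟩ := this
  exact ⟨f, by rw [← hf]; ring⟩

lemma dvd_eval_of_dvd_coeff {r : ℤ} {g : ℤ[X]} (h : ∀ i, r ∣ g.coeff i) (a : ℤ) :
    r ∣ g.eval a := by
  obtain ⟨f, rfl⟩ := (C_dvd_iff_dvd_coeff r g).2 h
  simp

lemma dvd_eval_sub_coeff_zero {r : ℤ} {g : ℤ[X]} (h : ∀ i, 1 ≤ i → r ∣ g.coeff i) (a : ℤ) :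
    r ∣ g.eval a - g.coeff 0 := by
  obtain ⟨f, hf⟩ := exists_content_quotient h
  have := congrArg (eval a) hf
  rw [eval_add, eval_mul, eval_C, eval_C] at this
  exact ⟨f.eval a, by rw [this]; ring⟩

lemma dvd_eval_sub_linear {r : ℤ} {g : ℤ[X]} (h : ∀ i, 2 ≤ i → r ∣ g.coeff i) (a : ℤ) :
    r ∣ g.eval a - (g.coeff 0 + g.coeff 1 * a) := by
  have h1 : r ∣ (divX g).eval a - (divX g).coeff 0 :=
    dvd_eval_sub_coeff_zero (fun i hi => by rw [coeff_divX]; exact h _ (by omega)) a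
  have h2 : g.eval a = (divX g).eval a * a + g.coeff 0 := by
    conv_lhs => rw [← divX_mul_X_add g]
    simp
  rw [coeff_divX] at h1
  have h3 : g.eval a - (g.coeff 0 + g.coeff 1 * a) = ((divX g).eval a - g.coeff 1) * a := by
    rw [h2]; ring
  rw [h3]
  exact h1.mul_right a

lemma dvd_hasseDeriv_eval {r : ℤ} {g : ℤ[X]} {d : ℕ} (h : ∀ i, d < i → r ∣ g.coeff i)
    {i : ℕ} (hi : d < i) (a : ℤ) : r ∣ (hasseDeriv i g).eval a :=
  dvd_eval_of_dvd_coeff (fun n => by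
    rw [hasseDeriv_coeff]; exact (h _ (by omega)).mul_left _) a

lemma dvd_hasseDeriv_eval_sub {r : ℤ} {g : ℤ[X]} {d : ℕ} (h : ∀ i, d < i → r ∣ g.coeff i)
    (a : ℤ) : r ∣ (hasseDeriv d g).eval a - g.coeff d := by
  have := dvd_eval_sub_coeff_zero (r := r) (g := hasseDeriv d g) (fun n hn => by
    rw [hasseDeriv_coeff]; exact (h _ (by omega)).mul_left _) a
  simpa [hasseDeriv_coeff] using this

lemma dvd_hasseDeriv_pred_eval_sub {r : ℤ} {g : ℤ[X]} {d : ℕ}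
    (h : ∀ i, d + 1 < i → r ∣ g.coeff i) (a : ℤ) :
    r ∣ (hasseDeriv d g).eval a - (g.coeff d + (d + 1) * g.coeff (d + 1) * a) := by
  have := dvd_eval_sub_linear (r := r) (g := hasseDeriv d g) (fun n hn => by
    rw [hasseDeriv_coeff]; exact (h _ (by omega)).mul_left _) a
  simpa [hasseDeriv_coeff, add_comm 1 d] using this

/-! ### Decay of the means for polynomials of bounded reduced degree -/

/-- The means of all polynomials of reduced degree at most `d` modulo `p` decay at least like
`C * θ ^ m`: the coefficients beyond index `d` are divisible by `p`, and some coefficient with index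
between `1` and `d` is not. -/
def HasDecay (p d : ℕ) (θ C : ℝ) : Prop :=
  ∀ g : ℤ[X], (∃ i, 1 ≤ i ∧ i ≤ d ∧ ¬ (p : ℤ) ∣ g.coeff i) →
    (∀ i, d < i → (p : ℤ) ∣ g.coeff i) → ∀ m, ‖mean p g m‖ ≤ C * θ ^ m

/-- Modulo `p ^ K` the polynomial `g` has degree `d`, with leading coefficient prime to `p`. -/
def IsDominated (p K d : ℕ) (g : ℤ[X]) : Prop :=
  ¬ (p : ℤ) ∣ g.coeff d ∧ ∀ i, d < i → (p : ℤ) ^ K ∣ g.coeff i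

lemma norm_mean_le_of_content (hp : p.Prime) {θ C : ℝ} (h0 : 0 < θ) (h1 : θ ≤ 1) (hC : 1 ≤ C)
    {g f : ℤ[X]} {b : ℤ} {c : ℕ} (hg : g = Polynomial.C b + Polynomial.C ((p : ℤ) ^ c) * f)
    (hf : ∀ m, ‖mean p f m‖ ≤ C * θ ^ m) (m : ℕ) : ‖mean p g m‖ ≤ C / θ ^ c * θ ^ m := by
  have hc0 : 0 < θ ^ c := pow_pos h0 c
  rw [div_mul_eq_mul_div, le_div_iff₀ hc0]
  rcases le_or_gt c m with hcm | hcm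
  · obtain ⟨m, rfl⟩ := Nat.exists_eq_add_of_le hcm
    rw [norm_mean_eq_of_content hp hg, pow_add]
    calc ‖mean p f m‖ * θ ^ c ≤ (C * θ ^ m) * θ ^ c := by gcongr; exact hf m
      _ = _ := by ring
  · have h3 : θ ^ c ≤ θ ^ m := pow_le_pow_of_le_one h0.le h1 hcm.le
    calc ‖mean p g m‖ * θ ^ c ≤ 1 * θ ^ m := by
          gcongr; exact norm_mean_le_one hp g m
      _ ≤ C * θ ^ m := by gcongr

/-- If the coefficients beyond index `d` are all more divisible by `p` than one of the coefficients
`1, …, d`, then removing the content of `g - g(0)` leaves a polynomial of reduced degree at most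
`d`, at the cost of a factor `θ ^ (-N)`. -/
lemma HasDecay.norm_mean_le (hp : p.Prime) {d : ℕ} {θ C : ℝ} (h0 : 0 < θ) (h1 : θ ≤ 1)
    (hC : 1 ≤ C) (hd : HasDecay p d θ C) {g : ℤ[X]} {N : ℕ}
    (hlow : ∃ i, 1 ≤ i ∧ i ≤ d ∧ ¬ (p : ℤ) ^ N ∣ g.coeff i)
    (hhigh : ∀ i, d < i → (p : ℤ) ^ N ∣ g.coeff i) (m : ℕ) :
    ‖mean p g m‖ ≤ C / θ ^ N * θ ^ m := by
  have hpz : (p : ℤ) ≠ 0 := by exact_mod_cast hp.ne_zero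
  obtain ⟨c, hcN, hc, hc'⟩ : ∃ c < N, (∀ i, 1 ≤ i → (p : ℤ) ^ c ∣ g.coeff i) ∧
      ¬ ∀ i, 1 ≤ i → (p : ℤ) ^ (c + 1) ∣ g.coeff i := by
    by_contra! hcon
    have : ∀ c ≤ N, ∀ i, 1 ≤ i → (p : ℤ) ^ c ∣ g.coeff i := by
      intro c
      induction c with
      | zero => simp
      | succ c ih => intro hc; exact hcon c (by omega) (ih (by omega))
    obtain ⟨i, hi, -, hn⟩ := hlow
    exact hn (this N le_rfl i hi)
  obtain ⟨f, hf⟩ := exists_content_quotient hc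
  have hcoef : ∀ i, 1 ≤ i → g.coeff i = (p : ℤ) ^ c * f.coeff i := by
    intro i hi
    rw [hf, coeff_add, coeff_C_of_ne_zero (by omega), zero_add, coeff_C_mul]
  have hhigh' : ∀ i, d < i → (p : ℤ) ∣ f.coeff i := by
    intro i hi
    have h2 := (pow_dvd_pow (p : ℤ) (show c + 1 ≤ N by omega)).trans (hhigh i hi)
    rw [hcoef i (by omega), pow_succ] at h2
    exact (mul_dvd_mul_iff_left (pow_ne_zero c hpz)).1 h2
  have hlow' : ∃ i, 1 ≤ i ∧ i ≤ d ∧ ¬ (p : ℤ) ∣ f.coeff i := by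
    push Not at hc'
    obtain ⟨i, hi, hn⟩ := hc'
    rw [hcoef i hi, pow_succ, mul_dvd_mul_iff_left (pow_ne_zero c hpz)] at hn
    exact ⟨i, hi, not_lt.1 fun h => hn (hhigh' i h), hn⟩
  refine (norm_mean_le_of_content hp h0 h1 hC hf (hd f hlow' hhigh') m).trans ?_
  have hθN : θ ^ N ≤ θ ^ c := pow_le_pow_of_le_one h0.le h1 hcN.le
  gcongr

/-- Linear case: the sum vanishes for `m ≥ 1`, since `g` permutes the residues. -/
lemma mean_eq_zero_of_linear (hp : p.Prime) {g : ℤ[X]} (h1 : ¬ (p : ℤ) ∣ g.coeff 1)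
    (h2 : ∀ i, 1 < i → (p : ℤ) ∣ g.coeff i) {m : ℕ} (hm : 1 ≤ m) : mean p g m = 0 := by
  induction m, hm using Nat.le_induction generalizing g with
  | base =>
    have hz : phase p (g.coeff 1) ≠ 1 := phase_ne_one hp.ne_zero h1
    have e : ∀ y : ℕ, phase p (g.eval (y : ℤ))
        = phase p (g.coeff 0) * phase p (g.coeff 1) ^ y := by
      intro y
      rw [← phase_nat_mul, ← phase_add]
      refine phase_congr ?_
      rw [mul_comm (y : ℤ)]
      exact dvd_eval_sub_linear (fun i hi => h2 i (by omega)) _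
    rw [mean]
    simp only [pow_one, e, ← mul_sum]
    rw [geom_sum_eq hz, ← phase_nat_mul, phase_eq_one_of_dvd (dvd_mul_right _ _)]
    simp
  | succ m hm ih =>
    rw [mean_eq_sum_rescale hp g _ 1, sum_eq_zero, zero_div]
    intro a _
    have hpz : (p : ℤ) ≠ 0 := by exact_mod_cast hp.ne_zero
    have hdvd : ∀ i, 1 ≤ i → (p : ℤ) ^ 1 ∣ (rescale p g a 1).coeff i := by
      intro i hi
      rw [coeff_rescale]
      exact (pow_dvd_pow _ (by omega)).mul_right _
    obtain ⟨f, hf⟩ := exists_content_quotient hdvd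
    have hcoef : ∀ i, 1 ≤ i →
        (p : ℤ) * f.coeff i = (p : ℤ) ^ (1 * i) * (hasseDeriv i g).eval (a : ℤ) := by
      intro i hi
      rw [← coeff_rescale, hf, coeff_add, coeff_C_of_ne_zero (by omega), zero_add, coeff_C_mul,
        pow_one]
    have key : mean p f m = 0 := by
      refine ih ?_ ?_
      · have := hcoef 1 le_rfl
        rw [mul_one, pow_one] at this
        rw [mul_left_cancel₀ hpz this]
        intro hdv
        exact h1 ((dvd_sub_right hdv).1 (dvd_hasseDeriv_eval_sub h2 _))
      · intro i hi
        have h3 := hcoef i (by omega)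
        obtain ⟨j, rfl⟩ : ∃ j, i = j + 2 := ⟨i - 2, by omega⟩
        rw [one_mul, pow_succ', mul_assoc] at h3
        rw [mul_left_cancel₀ hpz h3, pow_succ', mul_assoc]
        exact dvd_mul_right _ _
    rw [← norm_eq_zero, add_comm m 1, norm_mean_eq_of_content hp hf, key, norm_zero]

/-- One step of the recursion behind the decay estimate. At most one residue `a` modulo `p` is
exceptional, meaning that the Taylor coefficient of index `d` of `g` at some point of the class of
`a` is divisible by `p ^ (v + 1)`, where `v` is the order of `p` in `d + 1`; on all other classes that coefficient
is the least divisible after a further rescaling, and the estimate for reduced degree `d` applies. -/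
lemma norm_mean_le_of_dominated (hp : p.Prime) {d : ℕ} {κ C : ℝ} (h0 : 0 < κ) (h1 : κ ≤ 1)
    (hC : 1 ≤ C) (hd1 : 1 ≤ d) (hd : HasDecay p d κ C) {v : ℕ} (hv : (p : ℤ) ^ v ∣ (d + 1 : ℤ))
    (hv' : ¬ (p : ℤ) ^ (v + 1) ∣ (d + 1 : ℤ)) {m : ℕ} {M : ℝ} (hM0 : 0 ≤ M)
    (hM : ∀ g : ℤ[X], IsDominated p (v + 1) (d + 1) g → ‖mean p g m‖ ≤ M)
    {g : ℤ[X]} (hg : IsDominated p (v + 1) (d + 1) g) :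
    ‖mean p g (d + 1 + m)‖ ≤ C / κ ^ ((v + 2) * (d + 1)) * κ ^ (d + 1 + m) + M / p := by
  classical
  obtain ⟨hg1, hg2⟩ := hg
  have hpz : (p : ℤ) ≠ 0 := by exact_mod_cast hp.ne_zero
  have hpp : Prime (p : ℤ) := Nat.prime_iff_prime_int.1 hp
  have hg3 : ∀ i, d + 1 < i → (p : ℤ) ∣ g.coeff i := fun i hi =>
    (dvd_pow_self _ (Nat.succ_ne_zero v)).trans (hg2 i hi)
  set D := C / κ ^ ((v + 2) * (d + 1)) with hD
  have hD0 : 0 ≤ D * κ ^ (d + 1 + m) := by positivity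
  let exc : ℕ → Prop := fun a =>
    ∃ b : ℤ, (p : ℤ) ^ (v + 1) ∣ (hasseDeriv d g).eval ((a : ℤ) + p * b)
  have hregular : ∀ a : ℕ, ¬ exc a →
      ‖mean p (rescale p g a 1) (d + 1 + m)‖ ≤ D * κ ^ (d + 1 + m) := by
    intro a ha
    refine norm_mean_le_of_rescale hp _ _ (v + 1) fun b => ?_
    rw [rescale_rescale, pow_one]
    -- Index `d` has order at most `(v + 2) * d + v`, just below the `(v + 2) * (d + 1)` that the
    -- scaling alone gives to the indices beyond `d`.
    refine hd.norm_mean_le hp h0 h1 hC ⟨d, hd1, le_rfl, ?_⟩ ?_ _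
    · rw [coeff_rescale, show (v + 2) * (d + 1) = (1 + (v + 1)) * d + (v + 2) by ring, pow_add,
        mul_dvd_mul_iff_left (pow_ne_zero _ hpz)]
      intro h
      exact ha ⟨b, (pow_dvd_pow _ (by omega)).trans h⟩
    · intro i hi
      rw [coeff_rescale]
      exact (pow_dvd_pow _ (by rw [show 1 + (v + 1) = v + 2 by ring]; gcongr; omega)).mul_right _
  have hall : ∀ a : ℕ, ‖mean p (rescale p g a 1) (d + 1 + m)‖ ≤ D * κ ^ (d + 1 + m) + M := by
    intro a
    have hhigh : ∀ i, d < i → (p : ℤ) ^ (d + 1) ∣ (rescale p g a 1).coeff i := by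
      intro i hi
      rw [coeff_rescale]
      exact (pow_dvd_pow _ (by omega)).mul_right _
    by_cases hlow : ∃ i, 1 ≤ i ∧ i ≤ d ∧ ¬ (p : ℤ) ^ (d + 1) ∣ (rescale p g a 1).coeff i
    · have h2 := hd.norm_mean_le hp h0 h1 hC hlow hhigh (d + 1 + m)
      have h3 : C / κ ^ (d + 1) ≤ D := by
        rw [hD]
        refine div_le_div_of_nonneg_left (by linarith) (by positivity)
          (pow_le_pow_of_le_one h0.le h1 ?_)
        nlinarith
      have h4 : C / κ ^ (d + 1) * κ ^ (d + 1 + m) ≤ D * κ ^ (d + 1 + m) := by gcongr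
      linarith
    · push Not at hlow
      have hdvd : ∀ i, 1 ≤ i → (p : ℤ) ^ (d + 1) ∣ (rescale p g a 1).coeff i := fun i hi => by
        rcases le_or_gt i d with h | h
        · exact hlow i hi h
        · exact hhigh i h
      obtain ⟨f, hf⟩ := exists_content_quotient hdvd
      have hcoef : ∀ i, 1 ≤ i →
          (p : ℤ) ^ (d + 1) * f.coeff i = (p : ℤ) ^ i * (hasseDeriv i g).eval (a : ℤ) := by
        intro i hi
        have := coeff_rescale p g a 1 i
        rw [one_mul] at this
        rw [← this, hf, coeff_add, coeff_C_of_ne_zero (by omega), zero_add, coeff_C_mul]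
      rw [norm_mean_eq_of_content hp hf]
      have hfd : IsDominated p (v + 1) (d + 1) f := by
        refine ⟨?_, fun i hi => ?_⟩
        · rw [mul_left_cancel₀ (pow_ne_zero _ hpz) (hcoef (d + 1) (by omega))]
          intro hdv
          exact hg1 ((dvd_sub_right hdv).1 (dvd_hasseDeriv_eval_sub hg3 _))
        · refine (mul_dvd_mul_iff_left (pow_ne_zero (d + 1) hpz)).1 ?_
          rw [hcoef i (by omega)]
          exact mul_dvd_mul (pow_dvd_pow _ hi.le) (dvd_hasseDeriv_eval hg2 hi _)
      linarith [hM f hfd]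
  -- By linearity of the coefficient modulo `p ^ (v + 1)`, two exceptional residues coincide.
  have hunique : ∀ a a' : ℕ, exc a → exc a' → (p : ℤ) ∣ (a : ℤ) - a' := by
    rintro a a' ⟨b, hb⟩ ⟨b', hb'⟩
    have e1 := (dvd_sub_right hb).1 (dvd_hasseDeriv_pred_eval_sub hg2 _)
    have e2 := (dvd_sub_right hb').1 (dvd_hasseDeriv_pred_eval_sub hg2 _)
    obtain ⟨w, hw⟩ := hv
    have hw' : ¬ (p : ℤ) ∣ w := by
      rintro ⟨u, rfl⟩
      exact hv' ⟨u, by rw [hw]; ring⟩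
    have e3 := dvd_sub e1 e2
    have e4 : (p : ℤ) ∣ w * (g.coeff (d + 1) * ((a : ℤ) - a' + p * (b - b'))) := by
      refine (mul_dvd_mul_iff_left (pow_ne_zero v hpz)).1 ?_
      rw [← pow_succ]
      convert e3 using 1
      rw [hw]
      ring
    have e5 := ((hpp.dvd_or_dvd e4).resolve_left hw')
    have e6 := ((hpp.dvd_or_dvd e5).resolve_left hg1)
    exact (dvd_add_left (dvd_mul_right _ _)).1 e6
  have hcard : ((range p).filter exc).card ≤ 1 := by
    rw [card_le_one]
    intro a ha a' ha'
    rw [mem_filter, mem_range] at ha ha'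
    have := hunique a a' ha.2 ha'.2
    have h3 : a ≡ a' [MOD p] := ((Nat.modEq_iff_dvd).2 (by
      rw [← neg_sub]; exact (dvd_neg.2 this)))
    exact h3.eq_of_lt_of_lt ha.1 ha'.1
  have hp0 : (0 : ℝ) < p := by exact_mod_cast hp.pos
  rw [mean_eq_sum_rescale hp g _ 1, pow_one, pow_one, norm_div, Complex.norm_natCast,
    div_le_iff₀ hp0]
  have hbd : ∀ a ∈ range p, ‖mean p (rescale p g a 1) (d + 1 + m)‖
      ≤ D * κ ^ (d + 1 + m) + if exc a then M else 0 := by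
    intro a _
    split_ifs with h
    · exact hall a
    · simpa using hregular a h
  refine (norm_sum_le_of_le _ hbd).trans ?_
  rw [sum_add_distrib, ← sum_filter, sum_const, sum_const, card_range, nsmul_eq_mul, nsmul_eq_mul,
    add_mul, div_mul_cancel₀ _ hp0.ne', mul_comm (p : ℝ)]
  gcongr
  have : (((range p).filter exc).card : ℝ) ≤ 1 := by exact_mod_cast hcard
  nlinarith

/-- Solving the recursion: the strengthened bound `B * θ ^ m - E * κ ^ m` reproduces itself. -/
lemma exists_decay_of_dominated (hp : p.Prime) {d : ℕ} {κ θ C : ℝ} (h0 : 0 < κ) (h1 : κ < 1)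
    (hκθ : κ ≤ θ) (hθ1 : θ ≤ 1) (hκ : κ ^ d = (p : ℝ)⁻¹) (hθ : θ ^ (d + 1) = (p : ℝ)⁻¹)
    (hC : 1 ≤ C) (hd1 : 1 ≤ d) (hd : HasDecay p d κ C) {v : ℕ} (hv : (p : ℤ) ^ v ∣ (d + 1 : ℤ))
    (hv' : ¬ (p : ℤ) ^ (v + 1) ∣ (d + 1 : ℤ)) :
    ∃ B : ℝ, 1 ≤ B ∧ ∀ m, ∀ g : ℤ[X], IsDominated p (v + 1) (d + 1) g →
      ‖mean p g m‖ ≤ B * θ ^ m := by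
  have hθ0 : 0 < θ := h0.trans_le hκθ
  have hp0 : (0 : ℝ) < p := by exact_mod_cast hp.pos
  set D := C / κ ^ ((v + 2) * (d + 1)) with hD
  have hD0 : 0 < D := by positivity
  set E := D * κ / (1 - κ) with hE
  have hκ1 : 0 < 1 - κ := by linarith
  have hE0 : 0 < E := by positivity
  have hE1 : D + E = E / κ := by
    rw [hE]; field_simp; ring
  set B := (1 + E) / θ ^ (d + 1) with hB
  have hθd : θ ^ (d + 1) ≤ 1 := pow_le_one₀ hθ0.le hθ1
  have hB1 : 1 ≤ B := by
    rw [hB, le_div_iff₀ (by positivity)]; linarith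
  have key : ∀ m, ∀ g : ℤ[X], IsDominated p (v + 1) (d + 1) g →
      ‖mean p g m‖ ≤ B * θ ^ m - E * κ ^ m := by
    intro m
    induction m using Nat.strong_induction_on with
    | _ m ih =>
      intro g hg
      rcases lt_or_ge m (d + 1) with hm | hm
      · have e1 : θ ^ (d + 1) ≤ θ ^ m := pow_le_pow_of_le_one hθ0.le hθ1 hm.le
        have e2 : κ ^ m ≤ 1 := pow_le_one₀ h0.le h1.le
        have e3 : 1 + E ≤ B * θ ^ m := by
          calc 1 + E = B * θ ^ (d + 1) := by rw [hB]; field_simp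
            _ ≤ B * θ ^ m := by gcongr
        have e4 := norm_mean_le_one hp g m
        nlinarith
      · obtain ⟨m, rfl⟩ := Nat.exists_eq_add_of_le hm
        have hM := ih m (by omega)
        have hM0 : 0 ≤ B * θ ^ m - E * κ ^ m := (norm_nonneg _).trans (hM g hg)
        refine (norm_mean_le_of_dominated hp h0 h1.le hC hd1 hd hv hv' hM0 hM hg).trans_eq ?_
        rw [← hD, pow_add θ, hθ, sub_div, pow_add κ, pow_succ κ, hκ]
        have : D * κ = E - E * κ := by
          field_simp at hE1; linarith
        field_simp
        linear_combination (κ ^ m) * this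
  exact ⟨B, hB1, fun m g hg => (key m g hg).trans (by
    have : 0 < E * κ ^ m := by positivity
    linarith)⟩

/-- Induction step on the reduced degree: rescaling by `p ^ (v + 1)`, with `v` the order of `p` in
`d + 1`, makes the leading coefficient dominate the higher ones, unless a lower one dominates. -/
lemma HasDecay.succ (hp : p.Prime) {d : ℕ} {κ θ C : ℝ} (h0 : 0 < κ) (h1 : κ < 1)
    (hκθ : κ ≤ θ) (hθ1 : θ ≤ 1) (hκ : κ ^ d = (p : ℝ)⁻¹) (hθ : θ ^ (d + 1) = (p : ℝ)⁻¹)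
    (hC : 1 ≤ C) (hd1 : 1 ≤ d) (hd : HasDecay p d κ C) :
    ∃ C' : ℝ, 1 ≤ C' ∧ HasDecay p (d + 1) θ C' := by
  have hpz : (p : ℤ) ≠ 0 := by exact_mod_cast hp.ne_zero
  have hθ0 : 0 < θ := h0.trans_le hκθ
  obtain ⟨v, hv, hv'⟩ : ∃ v, (p : ℤ) ^ v ∣ (d + 1 : ℤ) ∧ ¬ (p : ℤ) ^ (v + 1) ∣ (d + 1 : ℤ) := by
    obtain ⟨v, w, hw, he⟩ := Nat.exists_eq_pow_mul_and_not_dvd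
      (Nat.succ_ne_zero d) p hp.ne_one
    have he' : (d + 1 : ℤ) = (p : ℤ) ^ v * w := by exact_mod_cast he
    refine ⟨v, ⟨w, he'⟩, fun h => hw ?_⟩
    rw [he', pow_succ, mul_dvd_mul_iff_left (pow_ne_zero v hpz)] at h
    exact_mod_cast h
  obtain ⟨B, hB1, hB⟩ := exists_decay_of_dominated hp h0 h1 hκθ hθ1 hκ hθ hC hd1 hd hv hv'
  set N := (v + 1) * (d + 1) with hN
  have hC'1 : 1 ≤ C / κ ^ N := by
    rw [le_div_iff₀ (by positivity)]
    have : κ ^ N ≤ 1 := pow_le_one₀ h0.le h1.le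
    linarith
  have hB'1 : B ≤ B / θ ^ N := by
    rw [le_div_iff₀ (by positivity)]
    have : θ ^ N ≤ 1 := pow_le_one₀ hθ0.le hθ1
    nlinarith
  refine ⟨C + C / κ ^ N + B / θ ^ N, by linarith, ?_⟩
  intro g hlow hhigh m
  have hpow : κ ^ m ≤ θ ^ m := pow_le_pow_left₀ h0.le hκθ m
  have hθm : 0 < θ ^ m := by positivity
  by_cases hlead : (p : ℤ) ∣ g.coeff (d + 1)
  · obtain ⟨i, hi, hid, hn⟩ := hlow
    have hid' : i ≤ d :=
      Nat.le_of_lt_succ (lt_of_le_of_ne hid fun h => hn (by rw [h]; exact hlead))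
    have := hd g ⟨i, hi, hid', hn⟩ (fun i hi => by
      rcases eq_or_ne i (d + 1) with rfl | h
      · exact hlead
      · exact hhigh i (by omega)) m
    calc ‖mean p g m‖ ≤ C * κ ^ m := this
      _ ≤ C * θ ^ m := by gcongr
      _ ≤ _ := by gcongr; linarith
  · refine norm_mean_le_of_rescale hp _ _ (v + 1) fun a => ?_
    have hhi : ∀ i, d < i → (p : ℤ) ^ N ∣ (rescale p g a (v + 1)).coeff i := by
      intro i hi
      rw [coeff_rescale]
      exact (pow_dvd_pow _ (Nat.mul_le_mul_left _ hi)).mul_right _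
    by_cases hlo : ∃ i, 1 ≤ i ∧ i ≤ d ∧ ¬ (p : ℤ) ^ N ∣ (rescale p g a (v + 1)).coeff i
    · calc ‖mean p (rescale p g a (v + 1)) m‖ ≤ C / κ ^ N * κ ^ m :=
            hd.norm_mean_le hp h0 h1.le hC hlo hhi m
        _ ≤ C / κ ^ N * θ ^ m := by gcongr
        _ ≤ _ := by gcongr; linarith
    · push Not at hlo
      have hdvd : ∀ i, 1 ≤ i → (p : ℤ) ^ N ∣ (rescale p g a (v + 1)).coeff i := fun i hi => by
        rcases le_or_gt i d with h | h
        · exact hlo i hi h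
        · exact hhi i h
      obtain ⟨f, hf⟩ := exists_content_quotient hdvd
      have hcoef : ∀ i, 1 ≤ i → (p : ℤ) ^ N * f.coeff i
          = (p : ℤ) ^ ((v + 1) * i) * (hasseDeriv i g).eval (a : ℤ) := by
        intro i hi
        rw [← coeff_rescale, hf, coeff_add, coeff_C_of_ne_zero (by omega), zero_add, coeff_C_mul]
      have hfd : IsDominated p (v + 1) (d + 1) f := by
        refine ⟨?_, fun i hi => ?_⟩
        · rw [mul_left_cancel₀ (pow_ne_zero _ hpz) (hcoef (d + 1) (by omega))]
          intro hdv
          exact hlead ((dvd_sub_right hdv).1 (dvd_hasseDeriv_eval_sub hhigh _))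
        · refine (mul_dvd_mul_iff_left (pow_ne_zero N hpz)).1 ?_
          rw [hcoef i (by omega), ← pow_add]
          refine (pow_dvd_pow _ ?_).mul_right _
          rw [hN]
          nlinarith
      exact (norm_mean_le_of_content hp hθ0 hθ1 hB1 hf (fun m => hB m f hfd) m).trans
        (by gcongr; linarith)

/-- Hua's estimate for polynomials of reduced degree at most `d`, with saving
`(p ^ m) ^ (-1 / d)`. -/
theorem exists_hasDecay (hp : p.Prime) {d : ℕ} (hd : 1 ≤ d) :
    ∃ C : ℝ, 1 ≤ C ∧ HasDecay p d ((p : ℝ) ^ (-(1 / (d : ℝ)))) C := by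
  have hp1 : (1 : ℝ) < p := by exact_mod_cast hp.one_lt
  have hpow : ∀ n : ℕ, 1 ≤ n → ((p : ℝ) ^ (-(1 / (n : ℝ)))) ^ n = (p : ℝ)⁻¹ := by
    intro n hn
    have hn' : (n : ℝ) ≠ 0 := by positivity
    rw [← Real.rpow_mul_natCast (by positivity), ← Real.rpow_neg_one]
    congr 1
    field_simp
  induction d, hd using Nat.le_induction with
  | base =>
    refine ⟨1, le_rfl, ?_⟩
    rintro g ⟨i, hi, hi', hn⟩ hhigh m
    obtain rfl : i = 1 := le_antisymm hi' hi
    rcases Nat.eq_zero_or_pos m with rfl | hm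
    · simpa using norm_mean_le_one hp g 0
    · rw [mean_eq_zero_of_linear hp hn hhigh hm, norm_zero]
      positivity
  | succ d hd ih =>
    obtain ⟨C, hC, h⟩ := ih
    have hd0 : (0 : ℝ) < d := by positivity
    refine h.succ hp (by positivity) ?_ ?_ ?_ (hpow d hd) (hpow (d + 1) (by omega)) hC hd
    · exact Real.rpow_lt_one_of_one_lt_of_neg hp1 (by rw [neg_lt_zero]; positivity)
    · refine Real.rpow_le_rpow_of_exponent_le hp1.le ?_
      push_cast
      gcongr
      linarith
    · refine Real.rpow_le_one_of_one_le_of_nonpos hp1.le ?_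
      rw [neg_nonpos]; positivity

/-! ### Binomial moments and sparse polynomials -/

/-- The functional `R ↦ ∑ j, c j * R (e j)` on integer polynomials vanishing at `0` is determined
integrally by its values on `choose X i` for `1 ≤ i ≤ s`: division by the monic
`X * ∏ j, (X - e j)` reduces the degree to at most `s`, and falling factorials are monic. -/
lemma dvd_sum_mul_eval {s : ℕ} {e : Fin s → ℕ} {c : Fin s → ℤ} {r : ℤ}
    (h : ∀ i, 1 ≤ i → i ≤ s → r ∣ ∑ j, c j * ((e j).choose i : ℤ))
    {R : ℤ[X]} (hR : R.eval 0 = 0) : r ∣ ∑ j, c j * R.eval (e j : ℤ) := by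
  have hpoch : ∀ n (k : ℕ), (descPochhammer ℤ n).eval (k : ℤ) = n.factorial * (k.choose n : ℤ) := by
    intro n k
    rw [descPochhammer_eval_eq_descFactorial, Nat.descFactorial_eq_factorial_mul_choose]
    push_cast; rfl
  have hlow : ∀ n ≤ s, ∀ R : ℤ[X], R.natDegree ≤ n → R.eval 0 = 0 →
      r ∣ ∑ j, c j * R.eval (e j : ℤ) := by
    intro n
    induction n with
    | zero =>
      intro _ R hdeg h0
      rw [eq_C_of_natDegree_le_zero hdeg, eval_C] at h0
      rw [eq_C_of_natDegree_le_zero hdeg, h0]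
      simp
    | succ n ih =>
      intro hn R hdeg h0
      set T := R - C (R.coeff (n + 1)) * descPochhammer ℤ (n + 1) with hT
      have hTdeg : T.natDegree ≤ n := by
        rw [natDegree_le_iff_coeff_eq_zero]
        intro i hi
        rw [hT, coeff_sub, coeff_C_mul]
        rcases eq_or_lt_of_le (Nat.succ_le_of_lt hi) with h1 | h1
        · have := (monic_descPochhammer ℤ (n + 1)).coeff_natDegree
          rw [descPochhammer_natDegree] at this
          rw [← h1, Nat.succ_eq_add_one, this]
          ring
        · rw [coeff_eq_zero_of_natDegree_lt (lt_of_le_of_lt hdeg h1),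
            coeff_eq_zero_of_natDegree_lt (p := descPochhammer ℤ (n + 1))
              (by rw [descPochhammer_natDegree]; exact h1)]
          ring
      have hT0 : T.eval 0 = 0 := by
        rw [hT, eval_sub, h0, eval_mul, descPochhammer_ne_zero_eval_zero ℤ (Nat.succ_ne_zero n)]
        simp
      have e1 := ih (by omega) T hTdeg hT0
      have e2 := (h (n + 1) (by omega) hn).mul_left (R.coeff (n + 1) * (n + 1).factorial)
      refine (dvd_add e1 e2).trans (dvd_of_eq ?_)
      rw [mul_sum, ← sum_add_distrib]
      refine sum_congr rfl fun j _ => ?_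
      rw [hT, eval_sub, eval_mul, eval_C, hpoch]
      ring
  set P : ℤ[X] := X * ∏ j, (X - C (e j : ℤ)) with hP
  have hPm : P.Monic := monic_X.mul (monic_prod_of_monic _ _ fun j _ => monic_X_sub_C _)
  have hPdeg : P.natDegree = s + 1 := by
    rw [hP, monic_X.natDegree_mul (monic_prod_of_monic _ _ fun j _ => monic_X_sub_C _),
      natDegree_X, natDegree_prod_of_monic _ _ fun j _ => monic_X_sub_C _]
    simp only [natDegree_X_sub_C, sum_const, card_univ, Fintype.card_fin, smul_eq_mul, mul_one]
    exact add_comm _ _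
  have hmod : ∀ x : ℤ, P.eval x = 0 → (R %ₘ P).eval x = R.eval x := by
    intro x hx
    conv_rhs => rw [← modByMonic_add_div R P]
    simp [hx]
  have hPe : ∀ j, P.eval (e j : ℤ) = 0 := by
    intro j
    rw [hP, eval_mul, eval_prod, prod_eq_zero (mem_univ j) (by simp), mul_zero]
  have hlt : (R %ₘ P).natDegree < s + 1 := by
    rw [← hPdeg]
    exact natDegree_modByMonic_lt R hPm (by rintro h1; rw [h1] at hPdeg; simp at hPdeg)
  have := hlow s le_rfl (R %ₘ P) (by omega) (by rw [hmod 0 (by simp [hP]), hR])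
  simpa only [hmod _ (hPe _)] using this

lemma dvd_factorial_mul_sum_choose {s : ℕ} {e : Fin s → ℕ} {c : Fin s → ℤ} {r : ℤ}
    (h : ∀ i, 1 ≤ i → i ≤ s → r ∣ ∑ j, c j * ((e j).choose i : ℤ)) {i : ℕ} (hi : 1 ≤ i) :
    r ∣ (i.factorial : ℤ) * ∑ j, c j * ((e j).choose i : ℤ) := by
  have := dvd_sum_mul_eval h
    (descPochhammer_ne_zero_eval_zero ℤ (n := i) (by omega))
  refine this.trans (dvd_of_eq ?_)
  rw [mul_sum]
  refine sum_congr rfl fun j _ => ?_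
  rw [descPochhammer_eval_eq_descFactorial, Nat.descFactorial_eq_factorial_mul_choose]
  push_cast; ring

lemma Delta_ne_zero {s : ℕ} {e : Fin s → ℕ} (he : Function.Injective e) (he1 : ∀ j, 1 ≤ e j) :
    Delta e ≠ 0 := by
  intro hdet
  obtain ⟨c, hc, hc0⟩ := Matrix.exists_mulVec_eq_zero_iff.2 hdet
  -- The relation extends to all polynomials vanishing at `0`, by divisibility by `0`.
  have h : ∀ i, 1 ≤ i → i ≤ s → (0 : ℤ) ∣ ∑ j, c j * ((e j).choose i : ℤ) := by
    intro i hi his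
    have := congrFun hc0 ⟨i - 1, by omega⟩
    simp only [Matrix.mulVec, dotProduct, Matrix.of_apply, Pi.zero_apply,
      Nat.sub_add_cancel hi] at this
    rw [zero_dvd_iff, ← this]
    exact sum_congr rfl fun j _ => mul_comm _ _
  refine hc (funext fun k => ?_)
  have h1 := dvd_sum_mul_eval h (R := X * ∏ j ∈ univ.erase k, (X - C (e j : ℤ))) (by simp)
  rw [zero_dvd_iff, sum_eq_single k] at h1
  · refine (mul_eq_zero.1 h1).resolve_right ?_
    rw [eval_mul, eval_X, eval_prod]
    refine mul_ne_zero (by have := he1 k; omega) (prod_ne_zero_iff.2 fun j hj => ?_)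
    rw [eval_sub, eval_X, eval_C, sub_ne_zero]
    exact fun h2 => (mem_erase.1 hj).1 (he (by exact_mod_cast h2.symm))
  · intro j _ hj
    rw [eval_mul, eval_prod, prod_eq_zero (mem_erase.2 ⟨hj, mem_univ j⟩) (by simp), mul_zero,
      mul_zero]
  · simp

/-- Cramer's rule: the order of `p` in `Delta e` limits the common divisibility of the first `s`
binomial moments. -/
lemma exists_not_dvd_sum_choose (hp : p.Prime) {s : ℕ} {e : Fin s → ℕ}
    (he : Function.Injective e) (he1 : ∀ j, 1 ≤ e j) {c : Fin s → ℤ} (hc : ∃ j, ¬ (p : ℤ) ∣ c j) :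
    ∃ i, 1 ≤ i ∧ i ≤ s ∧
      ¬ (p : ℤ) ^ (padicValInt p (Delta e) + 1) ∣ ∑ j, c j * ((e j).choose i : ℤ) := by
  by_contra! hcon
  have := Fact.mk hp
  set ρ := padicValInt p (Delta e) with hρ
  set M : Matrix (Fin s) (Fin s) ℤ := Matrix.of fun i j => ((e j).choose (i.val + 1) : ℤ) with hM
  have hdet : M.det = Delta e := rfl
  obtain ⟨k, hk⟩ := hc
  have h1 : ∀ i, (p : ℤ) ^ (ρ + 1) ∣ (M.mulVec c) i := by
    intro i
    have := hcon (i.val + 1) (by omega) (by omega)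
    simpa only [Matrix.mulVec, dotProduct, hM, Matrix.of_apply, mul_comm] using this
  have h2 : (p : ℤ) ^ (ρ + 1) ∣ (M.adjugate.mulVec (M.mulVec c)) k := by
    rw [Matrix.mulVec, dotProduct]
    exact dvd_sum fun i _ => (h1 i).mul_left _
  rw [Matrix.mulVec_mulVec, Matrix.adjugate_mul, Matrix.smul_mulVec, Matrix.one_mulVec,
    Pi.smul_apply, smul_eq_mul, hdet] at h2
  have h3 : (p : ℤ) ^ (ρ + 1) ∣ Delta e :=
    IsCoprime.dvd_of_dvd_mul_right
      (((Nat.prime_iff_prime_int.1 hp).coprime_iff_not_dvd.2 hk).pow_left) h2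
  rcases (padicValInt_dvd_iff _ _).1 h3 with h4 | h4
  · exact Delta_ne_zero he he1 h4
  · omega

lemma dvd_prime_pow_mul_of_dvd_factorial_mul (hp : p.Prime) {μ i : ℕ} {B : ℤ}
    (h : (p : ℤ) ^ μ ∣ (i.factorial : ℤ) * B) : (p : ℤ) ^ μ ∣ (p : ℤ) ^ i * B := by
  have := Fact.mk hp
  obtain ⟨t, w, hw, ht⟩ := Nat.exists_eq_pow_mul_and_not_dvd i.factorial_ne_zero p hp.ne_one
  have hti : t ≤ i := by
    have h1 : t ≤ padicValNat p i.factorial :=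
      (padicValNat_dvd_iff_le i.factorial_ne_zero).1 ⟨w, ht⟩
    have h2 := sub_one_mul_padicValNat_factorial (p := p) i
    have h3 := hp.two_le
    have h4 : 1 * padicValNat p i.factorial ≤ (p - 1) * padicValNat p i.factorial :=
      Nat.mul_le_mul_right _ (by omega)
    omega
  have hwc : IsCoprime ((p : ℤ) ^ μ) (w : ℤ) :=
    (((Nat.prime_iff_prime_int.1 hp).coprime_iff_not_dvd.2
      (by exact_mod_cast hw))).pow_left
  rw [ht] at h
  push_cast at h
  rw [mul_comm ((p : ℤ) ^ t), mul_assoc] at h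
  exact (hwc.dvd_of_dvd_mul_left h).trans (mul_dvd_mul_right (pow_dvd_pow _ hti) _)

/-- Hasse derivatives of a sparse polynomial at `a`, expressed by binomial moments. -/
lemma pow_mul_hasseDeriv_eval {s : ℕ} (e : Fin s → ℕ) (A : Fin s → ℤ) (a : ℤ) (i : ℕ) :
    a ^ i * (hasseDeriv i (∑ j, C (A j) * X ^ e j)).eval a
      = ∑ j, (A j * a ^ e j) * ((e j).choose i : ℤ) := by
  rw [map_sum, eval_finsetSum, mul_sum]
  refine sum_congr rfl fun j _ => ?_
  rw [C_mul_X_pow_eq_monomial, hasseDeriv_monomial, eval_monomial]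
  rcases lt_or_ge (e j) i with h | h
  · simp [Nat.choose_eq_zero_of_lt h]
  · rw [show a ^ i * (((e j).choose i : ℤ) * A j * a ^ (e j - i))
      = (a ^ i * a ^ (e j - i)) * A j * ((e j).choose i : ℤ) by ring, ← pow_add,
      Nat.add_sub_cancel' h]
    ring

/-- On a ball of radius `p ^ (-(s + 2))` about a unit, a sparse polynomial with `s` terms has
reduced degree at most `s`, and its content is controlled by `Delta e`. The radius is small enough
for the factors `p ^ ((s + 2) * i)` to outweigh the loss of `i!` in the coefficients beyond `s`. -/
lemma norm_mean_rescale_sparse_le (hp : p.Prime) {s : ℕ} {e : Fin s → ℕ}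
    (he : Function.Injective e) (he1 : ∀ j, 1 ≤ e j) {A : Fin s → ℤ} (hA : ∃ j, ¬ (p : ℤ) ∣ A j)
    {θ C : ℝ} (h0 : 0 < θ) (h1 : θ ≤ 1) (hC : 1 ≤ C) (hd : HasDecay p s θ C) {a : ℤ}
    (ha : ¬ (p : ℤ) ∣ a) (m : ℕ) :
    ‖mean p (rescale p (∑ j, Polynomial.C (A j) * X ^ e j) a (s + 2)) m‖
      ≤ C / θ ^ (padicValInt p (Delta e) + (s + 1) ^ 2) * θ ^ m := by
  have hpz : (p : ℤ) ≠ 0 := by exact_mod_cast hp.ne_zero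
  have hpp : Prime (p : ℤ) := Nat.prime_iff_prime_int.1 hp
  set ρ := padicValInt p (Delta e) with hρ
  set B : ℕ → ℤ := fun i => ∑ j, (A j * a ^ e j) * ((e j).choose i : ℤ) with hB
  have hcop : ∀ N i, IsCoprime ((p : ℤ) ^ N) (a ^ i) := fun N i =>
    (hpp.coprime_iff_not_dvd.2 ha).pow
  have hcoef : ∀ N i, (p : ℤ) ^ N ∣ (rescale p (∑ j, Polynomial.C (A j) * X ^ e j) a
      (s + 2)).coeff i ↔ (p : ℤ) ^ N ∣ (p : ℤ) ^ ((s + 2) * i) * B i := by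
    intro N i
    rw [coeff_rescale, hB]
    simp only
    rw [← pow_mul_hasseDeriv_eval, mul_left_comm]
    exact ⟨fun h => h.mul_left _, fun h => (hcop N i).dvd_of_dvd_mul_left h⟩
  obtain ⟨i₀, hi₀, hi₀s, hn₀⟩ := exists_not_dvd_sum_choose hp he he1
    (c := fun j => A j * a ^ e j) (by
      obtain ⟨j, hj⟩ := hA
      exact ⟨j, fun h => hj ((hpp.dvd_or_dvd h).resolve_right fun h' =>
        ha (hpp.dvd_of_dvd_pow h'))⟩)
  obtain ⟨μ, hμρ, hμ, hμ'⟩ : ∃ μ ≤ ρ, (∀ i, 1 ≤ i → i ≤ s → (p : ℤ) ^ μ ∣ B i) ∧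
      ∃ i, 1 ≤ i ∧ i ≤ s ∧ ¬ (p : ℤ) ^ (μ + 1) ∣ B i := by
    by_contra! hcon
    have : ∀ μ ≤ ρ + 1, ∀ i, 1 ≤ i → i ≤ s → (p : ℤ) ^ μ ∣ B i := by
      intro μ
      induction μ with
      | zero => simp
      | succ μ ih => intro hμ; exact hcon μ (by omega) (ih (by omega))
    exact hn₀ (this _ le_rfl i₀ hi₀ hi₀s)
  have hN : μ + (s + 1) ^ 2 ≤ ρ + (s + 1) ^ 2 := by omega
  have hmain : ‖mean p (rescale p (∑ j, Polynomial.C (A j) * X ^ e j) a (s + 2)) m‖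
      ≤ C / θ ^ (μ + (s + 1) ^ 2) * θ ^ m := by
    refine hd.norm_mean_le hp h0 h1 hC ?_ ?_ m
    · obtain ⟨i, hi, his, hni⟩ := hμ'
      refine ⟨i, hi, his, ?_⟩
      rw [hcoef]
      intro h
      have h2 : (s + 2) * i + (μ + 1) ≤ μ + (s + 1) ^ 2 := by nlinarith
      have h3 := (pow_dvd_pow (p : ℤ) h2).trans h
      rw [pow_add, mul_dvd_mul_iff_left (pow_ne_zero _ hpz)] at h3
      exact hni h3
    · intro i hi
      rw [hcoef]
      have h2 := dvd_prime_pow_mul_of_dvd_factorial_mul hp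
        (dvd_factorial_mul_sum_choose hμ (show 1 ≤ i by omega))
      have h3 := mul_dvd_mul (pow_dvd_pow (p : ℤ) (show (s + 1) ^ 2 ≤ (s + 1) * i by
        rw [pow_two]; exact Nat.mul_le_mul_left _ hi)) h2
      rw [← pow_add, ← mul_assoc, ← pow_add] at h3
      rwa [add_comm ((s + 1) ^ 2), show (s + 1) * i + i = (s + 2) * i by ring] at h3
  refine hmain.trans ?_
  have : θ ^ (ρ + (s + 1) ^ 2) ≤ θ ^ (μ + (s + 1) ^ 2) := pow_le_pow_of_le_one h0.le h1 hN
  gcongr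

lemma eMod_eval {α : ℕ} (hp : p.Prime) {s : ℕ} (e : Fin s → ℕ) (A : Fin s → ZMod (p ^ α)) (x : ℕ) :
    eMod (p ^ α) ((∑ j, C (A j) * X ^ e j).eval (x : ZMod (p ^ α)))
      = phase (p ^ α) ((∑ j, C ((A j).val : ℤ) * X ^ e j).eval (x : ℤ)) := by
  have : NeZero (p ^ α) := ⟨pow_ne_zero _ hp.ne_zero⟩
  set z := (∑ j, C (A j) * X ^ e j).eval (x : ZMod (p ^ α)) with hz
  have h1 : eMod (p ^ α) z = phase (p ^ α) (z.val : ℤ) := by simp [eMod, phase]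
  rw [h1]
  refine phase_congr ?_
  rw [← ZMod.intCast_zmod_eq_zero_iff_dvd]
  push_cast
  rw [ZMod.natCast_zmod_val, hz]
  simp only [eval_finsetSum, eval_mul, eval_C, eval_pow, eval_X]
  push_cast
  simp only [ZMod.natCast_zmod_val, sub_self]

/-- The sum over units, as a sum over the residues prime to `p`. -/
lemma expSum_eq {α : ℕ} (hp : p.Prime) (hα : 1 ≤ α) {s : ℕ} (e : Fin s → ℕ)
    (A : Fin s → ZMod (p ^ α)) :
    expSum (p ^ α) (∑ j, C (A j) * X ^ e j)
      = ∑ x ∈ range (p ^ α), if (p : ℤ) ∣ (x : ℤ) then 0 else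
          phase (p ^ α) ((∑ j, C ((A j).val : ℤ) * X ^ e j).eval (x : ℤ)) := by
  rw [expSum]
  simp only [eMod_eval hp]
  simp only [← ite_not (p := (p : ℤ) ∣ _)]
  rw [← sum_filter]
  refine sum_congr ?_ fun _ _ => rfl
  ext x
  have hcop : x.gcd (p ^ α) = 1 ↔ ¬ (p : ℤ) ∣ (x : ℤ) := by
    rw [← Nat.coprime_iff_gcd_eq_one, Nat.coprime_pow_right_iff (by omega), Nat.coprime_comm,
      hp.coprime_iff_not_dvd, Int.natCast_dvd_natCast]
  simp only [mem_filter, mem_Icc, mem_range, hcop, and_congr_left_iff]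
  intro hx
  have h0 : x ≠ 0 := by rintro rfl; simp at hx
  have h1 : x ≠ p ^ α := by
    rintro rfl
    exact hx (by exact_mod_cast dvd_pow_self p (by omega))
  omega

lemma norm_unit_sum_le (hp : p.Prime) (g : ℤ[X]) (α k : ℕ) (hk : 1 ≤ k) {T : ℝ} (hT : 0 ≤ T)
    (h : ∀ a : ℕ, ¬ (p : ℤ) ∣ (a : ℤ) → ‖mean p (rescale p g a k) α‖ ≤ T) (hα : 1 ≤ α) :
    ‖∑ x ∈ range (p ^ α), if (p : ℤ) ∣ (x : ℤ) then 0 else phase (p ^ α) (g.eval (x : ℤ))‖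
      ≤ (p : ℝ) ^ α * T := by
  have hp0 : (0 : ℝ) < p := by exact_mod_cast hp.pos
  have hpc : (p : ℂ) ≠ 0 := by exact_mod_cast hp.ne_zero
  have hunit : ∀ (n : ℕ) (y z : ℤ), 1 ≤ n → ((p : ℤ) ∣ y + (p : ℤ) ^ n * z ↔ (p : ℤ) ∣ y) :=
    fun n y z hn => dvd_add_left ((dvd_pow_self _ (by omega)).mul_right _)
  have hsplit := sum_period_split
    (fun x => if (p : ℤ) ∣ x then 0 else phase (p ^ α) (g.eval x)) (p ^ α) (p ^ k) (by
      intro y z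
      have := phase_eval_periodic (p ^ α) g y z
      push_cast at this ⊢
      simp only [hunit α y z hα, this])
  push_cast at hsplit
  have hin : ∀ a : ℕ, ‖∑ z ∈ range (p ^ α), (if (p : ℤ) ∣ (a : ℤ) + (p : ℤ) ^ k * z then (0 : ℂ)
      else phase (p ^ α) (g.eval ((a : ℤ) + (p : ℤ) ^ k * z)))‖ ≤ (p : ℝ) ^ α * T := by
    intro a
    simp only [hunit k _ _ hk]
    by_cases ha : (p : ℤ) ∣ (a : ℤ)
    · simp only [ha, if_true, sum_const_zero, norm_zero]
      positivity
    · have h1 := h a ha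
      rw [mean, norm_div, norm_pow, Complex.norm_natCast, div_le_iff₀ (by positivity)] at h1
      simpa only [ha, if_false, eval_rescale, mul_comm T] using h1
  have h2 := congrArg norm hsplit
  rw [norm_mul, norm_pow, Complex.norm_natCast] at h2
  have h3 := norm_sum_le_of_le (range (p ^ k)) (fun a _ => hin a)
  rw [← h2, sum_const, card_range, nsmul_eq_mul] at h3
  push_cast at h3
  exact le_of_mul_le_mul_left h3 (by positivity)

end SparseExpSum

open SparseExpSum in
theorem lemma3p1 (p : ℕ) (hp : p.Prime) (s : ℕ) (hs : 1 ≤ s) (η : ℝ) (hη : 0 < η) :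
    ∃ C : ℝ, 0 < C ∧
      ∀ (α : ℕ), 1 ≤ α →
      ∀ (e : Fin s → ℕ), StrictMono e → (∀ j, 1 ≤ e j) →
      ∀ (A : Fin s → ZMod (p ^ α)),
        Nat.gcd (Finset.univ.gcd fun j => (A j).val) p = 1 →
        (p : ℝ) ^ padicValInt p (SparseExpSum.Delta e) ≤ (s : ℝ)⁻¹ * ((p ^ α : ℕ) : ℝ) ^ η →
        ‖SparseExpSum.expSum (p ^ α)
            (∑ j, Polynomial.C (A j) * Polynomial.X ^ e j)‖
          ≤ C * ((p ^ α : ℕ) : ℝ) ^ (1 - 1 / (s : ℝ) + η * ((s : ℝ) + 1) / (s : ℝ)) := by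
  obtain ⟨C, hC, hdecay⟩ := exists_hasDecay hp hs
  have hp0 : (0 : ℝ) < p := by exact_mod_cast hp.pos
  have hp1 : (1 : ℝ) ≤ p := by exact_mod_cast hp.one_lt.le
  have hs1 : (1 : ℝ) ≤ s := by exact_mod_cast hs
  have hs0 : (0 : ℝ) < s := by linarith
  set θ := (p : ℝ) ^ (-(1 / (s : ℝ))) with hθ
  have h0 : 0 < θ := by positivity
  have h1 : θ ≤ 1 :=
    Real.rpow_le_one_of_one_le_of_nonpos hp1 (by rw [neg_nonpos]; positivity)
  refine ⟨C / θ ^ ((s + 1) ^ 2), by positivity, ?_⟩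
  intro α hα e he he1 A hA hρ
  set ρ := padicValInt p (Delta e) with hρdef
  have hA' : ∃ j, ¬ (p : ℤ) ∣ ((A j).val : ℤ) := by
    by_contra! hcon
    have : p ∣ Nat.gcd (Finset.univ.gcd fun j => (A j).val) p :=
      Nat.dvd_gcd (Finset.dvd_gcd fun j _ => by exact_mod_cast hcon j) dvd_rfl
    rw [hA] at this
    exact hp.one_lt.ne' (Nat.dvd_one.1 this)
  rw [expSum_eq hp hα]
  refine (norm_unit_sum_le hp _ α (s + 2) (by omega) (by positivity) (fun a ha =>
    norm_mean_rescale_sparse_le hp he.injective he1 hA' h0 h1 hC hdecay ha α) hα).trans ?_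
  push_cast at hρ ⊢
  set q := (p : ℝ) ^ α with hq
  have hq1 : 1 ≤ q := one_le_pow₀ hp1
  have hq0 : 0 < q := by linarith
  have hθα : θ ^ α = q ^ (-(1 / (s : ℝ))) := by
    rw [hθ, hq, ← Real.rpow_natCast, ← Real.rpow_natCast, ← Real.rpow_mul hp0.le,
      ← Real.rpow_mul hp0.le, mul_comm]
  have hθρ : (θ ^ ρ)⁻¹ ≤ q ^ (η / s) := by
    have e1 : (θ ^ ρ)⁻¹ = ((p : ℝ) ^ ρ) ^ (1 / (s : ℝ)) := by
      rw [hθ, ← Real.rpow_natCast, ← Real.rpow_natCast, ← Real.rpow_mul hp0.le,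
        ← Real.rpow_mul hp0.le, ← Real.rpow_neg hp0.le]
      congr 1
      ring
    have e2 : (p : ℝ) ^ ρ ≤ q ^ η := hρ.trans
      (mul_le_of_le_one_left (by positivity) (inv_le_one_of_one_le₀ hs1))
    rw [e1]
    calc ((p : ℝ) ^ ρ) ^ (1 / (s : ℝ)) ≤ (q ^ η) ^ (1 / (s : ℝ)) :=
          Real.rpow_le_rpow (by positivity) e2 (by positivity)
      _ = q ^ (η / s) := by rw [← Real.rpow_mul hq0.le, mul_one_div]
  have hexp : q * q ^ (-(1 / (s : ℝ))) * q ^ (η / s)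
      ≤ q ^ (1 - 1 / (s : ℝ) + η * ((s : ℝ) + 1) / (s : ℝ)) := by
    nth_rewrite 1 [← Real.rpow_one q]
    rw [← Real.rpow_add hq0, ← Real.rpow_add hq0]
    refine Real.rpow_le_rpow_of_exponent_le hq1 ?_
    have : η / s ≤ η * ((s : ℝ) + 1) / s := by
      gcongr
      nlinarith
    linarith
  calc q * (C / θ ^ (ρ + (s + 1) ^ 2) * θ ^ α)
      = C / θ ^ ((s + 1) ^ 2) * (q * θ ^ α * (θ ^ ρ)⁻¹) := by
        rw [pow_add]; field_simp
    _ ≤ C / θ ^ ((s + 1) ^ 2) * (q * q ^ (-(1 / (s : ℝ))) * q ^ (η / s)) := by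
        rw [hθα]; gcongr
    _ ≤ _ := by gcongr
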